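/- Let $\mathbb R^n$ carry an arbitrary norm $\|\cdot\|$, let $\|\cdot\|$ also denote the induced norm on $n\times n$ matrices, and let $\mu(C)=\lim_{\nu\to0^+}\nu^{-1}(\|I+\nu C\|-1)$ be the corresponding matrix measure (logarithmic norm). Let $t_0\ge 0$. For $k=1,\dots,m$ let $B_k:[t_0,\infty)\to\mathbb R^{n\times n}$ be Lebesgue measurable and essentially bounded, and let $h_k:[t_0,\infty)\to\mathbb R$ be Lebesgue measurable with $0\le t-h_k(t)\le\tau_k$ for all $t\ge t_0$, where the $\tau_k$ are constants. Put $B(t)=\sum_{k=1}^m B_k(t)$, $\tau=\max_k\tau_k$ and $\|F\|_{[t_0,\infty)}=\operatorname{ess\,sup}_{t\ge t_0}\|F(t)\|$. Consider the delay system $$\dot x(t)=\sum_{k=1}^m B_k(t)\,x(h_k(t)).\qquad(*)$$ For $s\ge t_0$ and a bounded Borel measurable $\Phi:[s-\tau,s]\to\mathbb R^n$, a solution of $(*)$ with initial time $s$ and initial function $\Phi$ is a function $x$ that is locally absolutely continuous on $[s,\infty)$, satisfies $(*)$ for almost all $t\ge s$, and equals $\Phi$ on $[s-\tau,s]$. Suppose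 that there is a constant $\beta>0$ with $\mu(B(t))\le-\beta$ for all $t\ge t_0$, and that at least one of the following conditions holds: 1. $\displaystyle \Big(\sum_{k=1}^m\|B_k\|_{[t_0,\infty)}\Big)\Big(\sum_{k=1}^m\tau_k\Big\|\frac{B_k}{\mu(B)}\Big\|_{[t_0,\infty)}\Big)<1$; 2. $\displaystyle \|B\|_{[t_0,\infty)}\sum_{k=1}^m\tau_k\Big\|\frac{B_k}{\mu(B)}\Big\|_{[t_0,\infty)}<1-\sum_{k=1}^m\tau_k\|B_k\|_{[t_0,\infty)}$. Then $(*)$ is uniformly exponentially stable: there are constants $M>0$ and $\gamma>0$ such that, for every $s\ge t_0$, every bounded Borel measurable $\Phi:[s-\tau,s]\to\mathbb R^n$ and every solution $x$ of $(*)$ with initial time $s$ and initial function $\Phi$, $$\|x(t)\|\le M e^{-\gamma(t-s)}\sup_{u\in[s-\tau,s]}\|\Phi(u)\|\qquad\text{for all }t\ge s.$$ -/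

import Mathlib

open MeasureTheory Set Filter Topology

/-! Linear delay systems `x'(t) = ∑ₖ Bₖ(t) x(hₖ(t))` in a finite-dimensional real normed space `E`,
that is, in `ℝⁿ` with an arbitrary norm.  Matrices are the (automatically continuous) linear
operators `E →L[ℝ] E`, and their norm is the induced operator norm. -/

namespace DelaySystem

variable {E : Type*} [NormedAddCommGroup E] [NormedSpace ℝ E]

/-- The matrix measure (logarithmic norm)
`μ(C) = lim_{ν → 0⁺} (‖I + ν C‖ - 1) / ν`.  The limit exists, see `tendsto_matrixMeasure`. -/
noncomputable def matrixMeasure (C : E →L[ℝ] E) : ℝ :=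
  limUnder (𝓝[>] (0 : ℝ)) fun ν : ℝ => ν⁻¹ * (‖ContinuousLinearMap.id ℝ E + ν • C‖ - 1)

/-- In a nonzero space the limit that defines the matrix measure exists. -/
theorem tendsto_matrixMeasure [Nontrivial E] (C : E →L[ℝ] E) :
    Tendsto (fun ν : ℝ => ν⁻¹ * (‖ContinuousLinearMap.id ℝ E + ν • C‖ - 1)) (𝓝[>] (0 : ℝ))
      (𝓝 (matrixMeasure C)) := by
  have h1 : ‖ContinuousLinearMap.id ℝ E‖ = 1 := ContinuousLinearMap.norm_id
  set q : ℝ → ℝ := fun ν => ν⁻¹ * (‖ContinuousLinearMap.id ℝ E + ν • C‖ - 1) with hq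
  have hmono : MonotoneOn q (Ioi 0) := by
    intro a ha b hb hab
    have ha' : (0 : ℝ) < a := ha
    have hb' : (0 : ℝ) < b := hb
    have key : b * ‖ContinuousLinearMap.id ℝ E + a • C‖
        ≤ (b - a) + a * ‖ContinuousLinearMap.id ℝ E + b • C‖ := by
      have e : b • (ContinuousLinearMap.id ℝ E + a • C)
          = (b - a) • ContinuousLinearMap.id ℝ E
            + a • (ContinuousLinearMap.id ℝ E + b • C) := by
        module
      calc b * ‖ContinuousLinearMap.id ℝ E + a • C‖
          = ‖b • (ContinuousLinearMap.id ℝ E + a • C)‖ := by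
            rw [norm_smul, Real.norm_of_nonneg hb'.le]
        _ ≤ ‖(b - a) • ContinuousLinearMap.id ℝ E‖
            + ‖a • (ContinuousLinearMap.id ℝ E + b • C)‖ := by
            rw [e]; exact norm_add_le _ _
        _ = _ := by
            rw [norm_smul, norm_smul, h1, Real.norm_of_nonneg ha'.le,
              Real.norm_of_nonneg (sub_nonneg.2 hab), mul_one]
    simp only [hq]
    rw [inv_mul_eq_div, inv_mul_eq_div, div_le_div_iff₀ ha' hb']
    nlinarith [key]
  have hbdd : BddBelow (q '' Ioi 0) := by
    refine ⟨-‖C‖, ?_⟩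
    rintro _ ⟨ν, hν, rfl⟩
    have hν' : (0 : ℝ) < ν := hν
    have h2 : ‖ContinuousLinearMap.id ℝ E‖ - ‖ν • C‖
        ≤ ‖ContinuousLinearMap.id ℝ E + ν • C‖ := by
      simpa using norm_sub_norm_le (ContinuousLinearMap.id ℝ E) (-(ν • C))
    rw [h1, norm_smul, Real.norm_of_nonneg hν'.le] at h2
    simp only [hq]
    rw [inv_mul_eq_div, le_div_iff₀ hν']
    nlinarith
  have hlim := hmono.tendsto_nhdsGT hbdd
  exact tendsto_nhds_limUnder ⟨_, hlim⟩

/-- The essential supremum norm `‖F‖_{[t₀,∞)} = ess sup_{t ≥ t₀} ‖F(t)‖`. It is only used for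
essentially bounded `F`, so the conversion to a real number loses nothing. -/
noncomputable def essNorm {V : Type*} [NormedAddCommGroup V] (t₀ : ℝ) (F : ℝ → V) : ℝ :=
  (eLpNorm F ⊤ (volume.restrict (Ici t₀))).toReal

/-- Standing assumptions on the coefficients and the delays on the half-line `[t₀, ∞)`:
each `Bₖ` is Lebesgue measurable and essentially bounded, each `hₖ` is Lebesgue measurable,
and `0 ≤ t - hₖ(t) ≤ τₖ`. -/
structure IsAdmissible {m : ℕ} (t₀ : ℝ) (B : Fin m → ℝ → E →L[ℝ] E) (h : Fin m → ℝ → ℝ)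
    (τ : Fin m → ℝ) : Prop where
  memLp : ∀ k, MemLp (B k) ⊤ (volume.restrict (Ici t₀))
  aemeasurable : ∀ k, AEMeasurable (h k) (volume.restrict (Ici t₀))
  delay_nonneg : ∀ k, ∀ t, t₀ ≤ t → 0 ≤ t - h k t
  delay_le : ∀ k, ∀ t, t₀ ≤ t → t - h k t ≤ τ k

/-- `Φ` is an initial function at the time `s` with memory length `r`:
it is bounded and Borel measurable on `[s - r, s]`. -/
structure IsInitialFunction [MeasurableSpace E] (s r : ℝ) (Φ : ℝ → E) : Prop where
  measurable : Measurable fun u : Icc (s - r) s => Φ u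
  bounded : BddAbove ((fun u => ‖Φ u‖) '' Icc (s - r) s)

/-- `x` solves `x'(t) = ∑ₖ Bₖ(t) x(hₖ(t))` for `t ≥ s`, `x(t) = Φ(t)` for `s - r ≤ t ≤ s`:
it is locally absolutely continuous on `[s, ∞)`, satisfies the system for almost all `t ≥ s`,
and satisfies the initial condition. -/
structure IsSolution {m : ℕ} (B : Fin m → ℝ → E →L[ℝ] E) (h : Fin m → ℝ → ℝ)
    (s r : ℝ) (Φ x : ℝ → E) : Prop where
  absolutelyContinuous : ∀ T, s ≤ T → AbsolutelyContinuousOnInterval x s T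
  hasDerivAt : ∀ᵐ t ∂volume.restrict (Ici s), HasDerivAt x (∑ k, B k t (x (h k t))) t
  initial : EqOn x Φ (Icc (s - r) s)

/-- Uniform exponential stability of `x'(t) = ∑ₖ Bₖ(t) x(hₖ(t))` on `[t₀, ∞)`: every solution
started at any time `s ≥ t₀` from any initial function `Φ` on `[s - maxₖ τₖ, s]` satisfies
`‖x(t)‖ ≤ M e^{-γ (t - s)} sup ‖Φ‖` for `t ≥ s`, with `M, γ > 0` independent of `s` and `Φ`. -/
def UniformlyExponentiallyStable [MeasurableSpace E] {m : ℕ} (t₀ : ℝ)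
    (B : Fin m → ℝ → E →L[ℝ] E) (h : Fin m → ℝ → ℝ) (τ : Fin m → ℝ) : Prop :=
  ∃ M > 0, ∃ γ > 0, ∀ s, t₀ ≤ s → ∀ Φ x : ℝ → E,
    IsInitialFunction s (⨆ k, τ k) Φ → IsSolution B h s (⨆ k, τ k) Φ x →
    ∀ t, s ≤ t →
      ‖x t‖ ≤ M * Real.exp (-γ * (t - s)) *
        sSup ((fun u => ‖Φ u‖) '' Icc (s - ⨆ k, τ k) s)

end DelaySystem

/-! Write the system as `x' = B x + ∑ Bₖ (x(hₖ) - x)` and weight norms by `exp (γ (t - s))`, with `γ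
> 0` small. The term `B x` damps `‖x‖` at rate `|μ(B)|` (`hasDerivAt_norm_le_matrixMeasure`). A
delayed difference is an integral of `x'` over length at most `τₖ`, so a bound `V` for the weighted
velocity bounds the perturbation by `∑ τₖ ‖Bₖ‖ exp (γ r) V`, where `r = maxₖ τₖ`. Since `‖Bₖ‖ ≤
‖Bₖ/μ(B)‖ |μ(B)|`, this is at most `|μ(B)| Q exp (γ r) V` with `Q = ∑ τₖ ‖Bₖ/μ(B)‖`. Damping and
perturbation thus carry the same factor `|μ(B)|`, and the weighted norm cannot grow above `Q exp (γ
r) V / (1 - γ/β)`.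

If `V` is at most `p` times the running maximum of the weighted norm, and `Q exp (γ r) p < 1 - γ/β`,
that maximum cannot be attained above the initial level (`le_of_contractive_level`). Under condition
1, `p = exp (γ r) ∑ ‖Bₖ‖` is read off the system. Under condition 2, the decomposition bounds the
velocity partly by itself, and `ae_le_of_self_improving_bound` gives `p = ‖B‖ / (1 - exp (γ r) ∑ τₖ
‖Bₖ‖)`. On `[s, s + r]`, where delays may reach the merely measurable initial function,
`norm_le_exp_mul` is used instead. -/

namespace AbsolutelyContinuousOnInterval

/-! ### Absolutely continuous functions and a maximum principle. -/

theorem norm {F : Type*} [SeminormedAddCommGroup F] {f : ℝ → F} {a b : ℝ}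
    (hf : AbsolutelyContinuousOnInterval f a b) :
    AbsolutelyContinuousOnInterval (fun t => ‖f t‖) a b := by
  refine squeeze_zero (fun _ => Finset.sum_nonneg fun _ _ => dist_nonneg) (fun _ => ?_) hf
  exact Finset.sum_le_sum fun i _ => (dist_norm_norm_le _ _).trans_eq (dist_eq_norm _ _).symm

theorem sub_le_mul_of_ae_hasDerivAt_le {f : ℝ → ℝ} {a b C : ℝ} (hab : a ≤ b)
    (hf : AbsolutelyContinuousOnInterval f a b)
    (hC : ∀ᵐ t, t ∈ Ioc a b → ∀ d, HasDerivAt f d t → d ≤ C) :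
    f b - f a ≤ C * (b - a) := by
  have key : ∫ t in a..b, deriv f t ≤ ∫ _t in a..b, C := by
    refine intervalIntegral.integral_mono_ae_restrict hab hf.intervalIntegrable_deriv
      intervalIntegrable_const ?_
    rw [EventuallyLE, ae_restrict_iff' measurableSet_Icc]
    have hne : ∀ᵐ t : ℝ, t ≠ a := by simp [ae_iff, measure_singleton]
    filter_upwards [hC, hf.ae_differentiableAt, hne] with t h1 h2 h3 ht
    exact h1 ⟨lt_of_le_of_ne ht.1 (Ne.symm h3), ht.2⟩ _
      (h2 (by rwa [uIcc_of_le hab])).hasDerivAt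
  rw [hf.integral_deriv_eq_sub, intervalIntegral.integral_const, smul_eq_mul] at key
  linarith

/-- Maximum principle: an absolutely continuous function that does not increase while it is
above the level `K` and starts below `K` stays below `K`. -/
theorem le_of_ae_hasDerivAt_nonpos {f : ℝ → ℝ} {a b K : ℝ} (hab : a ≤ b)
    (hf : AbsolutelyContinuousOnInterval f a b) (ha : f a ≤ K)
    (hK : ∀ᵐ t, t ∈ Icc a b → K < f t → ∀ d, HasDerivAt f d t → d ≤ 0) : f b ≤ K := by
  by_contra! hb
  set S : Set ℝ := Icc a b ∩ f ⁻¹' Iic K with hS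
  have hcont : ContinuousOn f (Icc a b) := by simpa [uIcc_of_le hab] using hf.continuousOn
  have hcl : IsClosed S := hcont.preimage_isClosed_of_isClosed isClosed_Icc isClosed_Iic
  have hne : S.Nonempty := ⟨a, ⟨le_rfl, hab⟩, ha⟩
  have hbd : BddAbove S := ⟨b, fun t ht => ht.1.2⟩
  -- The last time at which `f` is at most `K`; after it `f` stays above `K` and cannot increase.
  set c := sSup S with hc
  have hcS : c ∈ S := hcl.csSup_mem hne hbd
  have hfc : AbsolutelyContinuousOnInterval f c b := hf.mono (by
    rw [uIcc_of_le hab, uIcc_of_le hcS.1.2]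
    exact Icc_subset_Icc_left hcS.1.1)
  have h := hfc.sub_le_mul_of_ae_hasDerivAt_le (C := 0) hcS.1.2 (by
    filter_upwards [hK] with t ht htc
    have hmem : t ∈ Icc a b := ⟨hcS.1.1.trans htc.1.le, htc.2⟩
    refine ht hmem ?_
    by_contra! hle
    exact absurd (le_csSup hbd ⟨hmem, hle⟩) (not_le.2 htc.1))
  have h2 : f c ≤ K := hcS.2
  linarith

/-- If, as long as `f ≤ M` holds up to time `T`, the function `f` does not increase above the
level `max K (θ M)` with `θ < 1`, then `f` never exceeds `K`. -/
theorem le_of_contractive_level {f : ℝ → ℝ} {a K θ : ℝ}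
    (hf : ∀ T, a ≤ T → AbsolutelyContinuousOnInterval f a T) (hK0 : 0 ≤ K) (ha : f a ≤ K)
    (hθ : θ < 1)
    (hstep : ∀ T, a ≤ T → ∀ M, K ≤ M → (∀ u ∈ Icc a T, f u ≤ M) →
      ∀ᵐ t, t ∈ Icc a T → K < f t → θ * M < f t → ∀ d, HasDerivAt f d t → d ≤ 0)
    {t : ℝ} (ht : a ≤ t) : f t ≤ K := by
  have hcont : ContinuousOn f (Icc a t) := by
    simpa [uIcc_of_le ht] using (hf t ht).continuousOn
  -- Taking `M` to be the attained maximum `f c`, the maximum principle gives `f c ≤ max K (θ * f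
  -- c)`, impossible when `f c > K ≥ 0`.
  obtain ⟨c, hc, hmax⟩ := isCompact_Icc.exists_isMaxOn ⟨a, le_rfl, ht⟩ hcont
  have hle : ∀ u ∈ Icc a t, f u ≤ f c := fun u hu => hmax hu
  by_contra! hlt
  have hKc : K < f c := hlt.trans_le (hle t ⟨ht, le_rfl⟩)
  have hM := hstep t ht (f c) hKc.le hle
  have hac : AbsolutelyContinuousOnInterval f a c := hf c hc.1
  have := hac.le_of_ae_hasDerivAt_nonpos (K := max K (θ * f c)) hc.1 (ha.trans (le_max_left _ _))
    (by
      filter_upwards [hM] with u hu hmem hlev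
      exact hu ⟨hmem.1, hmem.2.trans hc.2⟩ ((le_max_left _ _).trans_lt hlev)
        ((le_max_right _ _).trans_lt hlev))
  rcases le_max_iff.1 this with h | h
  · linarith
  · nlinarith

end AbsolutelyContinuousOnInterval

/-! ### Self-improving bounds, and derivatives of norms and weighted functions. -/

theorem ae_le_of_self_improving_bound {α : Type*} [MeasurableSpace α] {μ : Measure α} {f : α → ℝ}
    {V₀ A D σ : ℝ} (hA : 0 ≤ A) (hσ0 : 0 ≤ σ) (hσ : σ < 1) (h0 : ∀ᵐ t ∂μ, f t ≤ V₀)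
    (himp : ∀ V, 0 ≤ V → (∀ᵐ t ∂μ, f t ≤ V) → ∀ᵐ t ∂μ, f t ≤ max A (D + σ * V)) :
    ∀ᵐ t ∂μ, f t ≤ max A (D / (1 - σ)) := by
  set c := max A (D / (1 - σ)) with hc
  have hc0 : 0 ≤ c := hA.trans (le_max_left _ _)
  -- Equivalently `D + σ c ≤ c`, so each iteration shrinks the excess over `c` by the factor `σ`.
  have hDc : D ≤ c * (1 - σ) := (div_le_iff₀ (sub_pos.2 hσ)).1 (le_max_right _ _)
  have hv : 0 ≤ max V₀ 0 := le_max_right _ _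
  have hn : ∀ n : ℕ, ∀ᵐ t ∂μ, f t ≤ c + σ ^ n * max V₀ 0 := by
    intro n
    induction n with
    | zero =>
      filter_upwards [h0] with t ht
      have := le_max_left V₀ 0
      simp only [pow_zero, one_mul]
      linarith
    | succ n ih =>
      filter_upwards [himp _ (by positivity) ih] with t ht
      refine ht.trans (max_le ?_ ?_)
      · exact (le_max_left A (D / (1 - σ))).trans (le_add_of_nonneg_right (by positivity))
      · rw [pow_succ]
        linarith
  filter_upwards [ae_all_iff.2 hn] with t ht
  have hlim : Tendsto (fun n : ℕ => c + σ ^ n * max V₀ 0) atTop (𝓝 (c + 0 * max V₀ 0)) :=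
    ((tendsto_pow_atTop_nhds_zero_of_lt_one hσ0 hσ).mul_const _).const_add _
  have := ge_of_tendsto' hlim ht
  simpa using this

theorem HasDerivAt.norm_le {E : Type*} [NormedAddCommGroup E] [NormedSpace ℝ E] {x : ℝ → E}
    {v : E} {t d : ℝ} (hx : HasDerivAt x v t) (hd : HasDerivAt (fun u => ‖x u‖) d t) :
    d ≤ ‖v‖ := by
  refine le_of_tendsto_of_tendsto hd.tendsto_slope_zero_right hx.tendsto_slope_zero_right.norm ?_
  filter_upwards [self_mem_nhdsWithin] with ν hν
  have hν' : (0 : ℝ) < ν⁻¹ := inv_pos.2 hν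
  rw [norm_smul, Real.norm_of_nonneg hν'.le, smul_eq_mul]
  exact mul_le_mul_of_nonneg_left (norm_sub_norm_le _ _) hν'.le

/-- Multiplying by the inverse exponential recovers `f`, so differentiability passes from the
weighted function to `f`. -/
theorem hasDerivAt_of_exp_mul {f : ℝ → ℝ} {γ s t w : ℝ}
    (hw : HasDerivAt (fun u => Real.exp (γ * (u - s)) * f u) w t) :
    ∃ d, HasDerivAt f d t ∧ w = Real.exp (γ * (t - s)) * (γ * f t + d) := by
  have hlin (c : ℝ) : HasDerivAt (fun u : ℝ => c * (u - s)) c t := by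
    simpa using ((hasDerivAt_id t).sub_const s).const_mul c
  have h2 := (hlin (-γ)).exp.mul hw
  have hfun : ((fun u => Real.exp (-γ * (u - s))) * fun u => Real.exp (γ * (u - s)) * f u) = f := by
    funext u
    simp only [Pi.mul_apply]
    rw [← mul_assoc, ← Real.exp_add]
    simp
  rw [hfun] at h2
  refine ⟨_, h2, ?_⟩
  have e : Real.exp (γ * (t - s)) * Real.exp (-γ * (t - s)) = 1 := by
    rw [← Real.exp_add]; simp
  linear_combination (Real.exp (γ * (t - s)) * γ * f t - w) * e

theorem AbsolutelyContinuousOnInterval.exp_mul {f : ℝ → ℝ} {a b : ℝ} (γ s : ℝ)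
    (hf : AbsolutelyContinuousOnInterval f a b) :
    AbsolutelyContinuousOnInterval (fun u => Real.exp (γ * (u - s)) * f u) a b := by
  have h : AbsolutelyContinuousOnInterval (fun u : ℝ => Real.exp (γ * (u - s))) a b := by
    refine ContDiffOn.absolutelyContinuousOnInterval (ContDiff.contDiffOn ?_)
    fun_prop
  exact h.mul hf

/-! ### The matrix measure as a growth rate, and essential suprema. -/

namespace DelaySystem

variable {E : Type*} [NormedAddCommGroup E] [NormedSpace ℝ E]

/-- Along a differentiable curve with velocity `C x + f` the norm grows at most at the rate
given by the matrix measure of `C`. -/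
theorem hasDerivAt_norm_le_matrixMeasure [Nontrivial E] {x : ℝ → E} {C : E →L[ℝ] E} {f : E}
    {t d : ℝ} (hx : HasDerivAt x (C (x t) + f) t) (hd : HasDerivAt (fun u => ‖x u‖) d t) :
    d ≤ matrixMeasure C * ‖x t‖ + ‖f‖ := by
  have h1 := ((tendsto_matrixMeasure C).mul_const ‖x t‖).add
    (hx.tendsto_slope_zero_right.sub_const (C (x t))).norm
  rw [add_sub_cancel_left] at h1
  refine le_of_tendsto_of_tendsto hd.tendsto_slope_zero_right h1 ?_
  filter_upwards [self_mem_nhdsWithin] with ν hν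
  have hν0 : (0 : ℝ) < ν := hν
  have hν' : (0 : ℝ) < ν⁻¹ := inv_pos.2 hν
  have e : x (t + ν) = (ContinuousLinearMap.id ℝ E + ν • C) (x t)
      + ν • (ν⁻¹ • (x (t + ν) - x t) - C (x t)) := by
    simp only [add_apply, ContinuousLinearMap.id_apply, smul_apply, smul_sub, smul_smul,
      mul_inv_cancel₀ hν0.ne', one_smul]
    abel
  have h2 : ‖x (t + ν)‖ ≤ ‖ContinuousLinearMap.id ℝ E + ν • C‖ * ‖x t‖
      + ν * ‖ν⁻¹ • (x (t + ν) - x t) - C (x t)‖ := by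
    conv_lhs => rw [e]
    refine (norm_add_le _ _).trans (add_le_add (ContinuousLinearMap.le_opNorm _ _) ?_)
    rw [norm_smul, Real.norm_of_nonneg hν0.le]
  rw [smul_eq_mul, inv_mul_le_iff₀ hν0]
  have e2 : ν * (ν⁻¹ * (‖ContinuousLinearMap.id ℝ E + ν • C‖ - 1) * ‖x t‖
      + ‖ν⁻¹ • (x (t + ν) - x t) - C (x t)‖) = (‖ContinuousLinearMap.id ℝ E + ν • C‖ - 1) * ‖x t‖
      + ν * ‖ν⁻¹ • (x (t + ν) - x t) - C (x t)‖ := by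
    field_simp
  rw [e2]
  linarith

theorem essNorm_nonneg {V : Type*} [NormedAddCommGroup V] (t₀ : ℝ) (F : ℝ → V) :
    0 ≤ essNorm t₀ F := ENNReal.toReal_nonneg

theorem ae_norm_le_essNorm {V : Type*} [NormedAddCommGroup V] {t₀ : ℝ} {F : ℝ → V}
    (hF : eLpNorm F ⊤ (volume.restrict (Ici t₀)) ≠ ⊤) :
    ∀ᵐ t, t₀ ≤ t → ‖F t‖ ≤ essNorm t₀ F := by
  have h : ∀ᵐ t ∂volume.restrict (Ici t₀), ‖F t‖ₑ ≤ eLpNorm F ⊤ (volume.restrict (Ici t₀)) := by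
    rw [eLpNorm_exponent_top]
    exact ae_le_eLpNormEssSup
  rw [ae_restrict_iff' measurableSet_Ici] at h
  filter_upwards [h] with t ht htt
  have := ENNReal.toReal_mono hF (ht htt)
  rwa [toReal_enorm] at this

end DelaySystem

/-! ### Bounds on admissible coefficients. -/

namespace DelaySystem

variable {E : Type*} [NormedAddCommGroup E] [NormedSpace ℝ E] {m : ℕ} {t₀ : ℝ}
  {B : Fin m → ℝ → E →L[ℝ] E} {h : Fin m → ℝ → ℝ} {τ : Fin m → ℝ}

theorem memLp_top_sum {V : Type*} [NormedAddCommGroup V] {F : Fin m → ℝ → V} {μ : Measure ℝ}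
    (hF : ∀ k, MemLp (F k) ⊤ μ) : MemLp (fun t => ∑ k, F k t) ⊤ μ :=
  memLp_finsetSum Finset.univ fun k _ => hF k

namespace IsAdmissible

theorem le_iSup (_hadm : IsAdmissible t₀ B h τ) (k : Fin m) : τ k ≤ ⨆ k, τ k :=
  le_ciSup (Set.finite_range τ).bddAbove k

theorem tau_nonneg (hadm : IsAdmissible t₀ B h τ) (k : Fin m) : 0 ≤ τ k :=
  (hadm.delay_nonneg k t₀ le_rfl).trans (hadm.delay_le k t₀ le_rfl)

theorem iSup_nonneg (hadm : IsAdmissible t₀ B h τ) : 0 ≤ ⨆ k, τ k :=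
  Real.iSup_nonneg hadm.tau_nonneg

theorem ae_norm_le (hadm : IsAdmissible t₀ B h τ) :
    ∀ᵐ t, t₀ ≤ t → ∀ k, ‖B k t‖ ≤ essNorm t₀ (B k) := by
  filter_upwards [ae_all_iff.2 fun k => ae_norm_le_essNorm (hadm.memLp k).2.ne] with t ht htt k
  exact ht k htt

theorem ae_norm_sum_le (hadm : IsAdmissible t₀ B h τ) :
    ∀ᵐ t, t₀ ≤ t → ‖∑ k, B k t‖ ≤ essNorm t₀ (fun t => ∑ k, B k t) :=
  ae_norm_le_essNorm (memLp_top_sum hadm.memLp).2.ne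

/-- If the matrix measure of `B(t)` is at most `-β < 0`, then `‖Bₖ(t)‖` is at most
`‖Bₖ / μ(B)‖ |μ(B(t))|` for almost all `t`. -/
theorem ae_norm_le_mul_matrixMeasure (hadm : IsAdmissible t₀ B h τ) {β : ℝ} (hβ : 0 < β)
    (hμ : ∀ t, t₀ ≤ t → matrixMeasure (∑ k, B k t) ≤ -β) :
    ∀ᵐ t, t₀ ≤ t → ∀ k, ‖B k t‖ ≤
      essNorm t₀ (fun t => (matrixMeasure (∑ j, B j t))⁻¹ • B k t) *
        -matrixMeasure (∑ j, B j t) := by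
  -- Finiteness must be proved because `essNorm` sends an infinite value to `0`; it follows from
  -- `|μ(B)| ≥ β`.
  have hfin : ∀ k, eLpNorm (fun t => (matrixMeasure (∑ j, B j t))⁻¹ • B k t) ⊤
      (volume.restrict (Ici t₀)) ≠ ⊤ := by
    intro k
    rw [eLpNorm_exponent_top]
    refine (eLpNormEssSup_lt_top_of_ae_bound (C := β⁻¹ * essNorm t₀ (B k)) ?_).ne
    rw [ae_restrict_iff' measurableSet_Ici]
    filter_upwards [hadm.ae_norm_le] with t ht htt
    rw [norm_smul, norm_inv]
    have h1 := hμ t htt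
    have h2 : β ≤ ‖matrixMeasure (∑ j, B j t)‖ := by
      rw [Real.norm_of_nonpos (by linarith)]
      linarith
    exact mul_le_mul (inv_anti₀ hβ h2) (ht htt k) (norm_nonneg _) (inv_nonneg.2 hβ.le)
  filter_upwards [ae_all_iff.2 fun k => ae_norm_le_essNorm (hfin k)] with t ht htt k
  have h1 := hμ t htt
  have h2 := ht k htt
  have h3 : 0 < -matrixMeasure (∑ j, B j t) := by linarith
  rw [norm_smul, norm_inv, Real.norm_of_nonpos (by linarith), inv_mul_le_iff₀ h3] at h2
  linarith

end IsAdmissible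

/-! ### Estimates along a solution. -/

namespace IsSolution

variable {s : ℝ} {Φ x : ℝ → E}

theorem ae_hasDerivAt {r : ℝ} (hx : IsSolution B h s r Φ x) :
    ∀ᵐ t, s ≤ t → HasDerivAt x (∑ k, B k t (x (h k t))) t :=
  (ae_restrict_iff' measurableSet_Ici).1 hx.hasDerivAt

/-- A weighted bound on the history of a solution gives a weighted bound on its velocity. -/
theorem ae_exp_mul_norm_velocity_le (hadm : IsAdmissible t₀ B h τ) (hs : t₀ ≤ s)
    {γ c M T : ℝ}
    (hc : ∀ δ, 0 ≤ δ → δ ≤ ⨆ k, τ k → γ * δ ≤ c)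
    (hM : ∀ u ∈ Icc (s - ⨆ k, τ k) T, Real.exp (γ * (u - s)) * ‖x u‖ ≤ M) :
    ∀ᵐ t, t ∈ Icc s T → Real.exp (γ * (t - s)) * ‖∑ k, B k t (x (h k t))‖ ≤
      (∑ k, essNorm t₀ (B k)) * (Real.exp c * M) := by
  filter_upwards [hadm.ae_norm_le] with t hB ht
  have htt : t₀ ≤ t := hs.trans ht.1
  have hk : ∀ k, Real.exp (γ * (t - s)) * ‖B k t (x (h k t))‖ ≤
      essNorm t₀ (B k) * (Real.exp c * M) := by
    intro k
    have d1 := hadm.delay_nonneg k t htt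
    have d2 := (hadm.delay_le k t htt).trans (hadm.le_iSup k)
    have h1 : Real.exp (γ * (t - s)) ≤ Real.exp c * Real.exp (γ * (h k t - s)) := by
      rw [← Real.exp_add, Real.exp_le_exp]
      linarith [hc _ d1 d2]
    have h2 := hM (h k t) ⟨by linarith [ht.1], by linarith [ht.2]⟩
    calc Real.exp (γ * (t - s)) * ‖B k t (x (h k t))‖
        ≤ Real.exp c * Real.exp (γ * (h k t - s)) * (essNorm t₀ (B k) * ‖x (h k t)‖) := by
          refine mul_le_mul h1 ?_ (norm_nonneg _) (by positivity)
          exact (ContinuousLinearMap.le_opNorm _ _).trans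
            (mul_le_mul_of_nonneg_right (hB htt k) (norm_nonneg _))
      _ = essNorm t₀ (B k) * (Real.exp c * (Real.exp (γ * (h k t - s)) * ‖x (h k t)‖)) := by ring
      _ ≤ _ := by
          have := essNorm_nonneg t₀ (B k)
          gcongr
  calc Real.exp (γ * (t - s)) * ‖∑ k, B k t (x (h k t))‖
      ≤ Real.exp (γ * (t - s)) * ∑ k, ‖B k t (x (h k t))‖ := by
        gcongr
        exact norm_sum_le _ _
    _ ≤ _ := by
        rw [Finset.mul_sum, Finset.sum_mul]
        exact Finset.sum_le_sum fun k _ => hk k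

/-- Exponential a priori bound, with the growth rate determined by the coefficients alone. -/
theorem norm_le_exp_mul (hadm : IsAdmissible t₀ B h τ) (hs : t₀ ≤ s)
    (hx : IsSolution B h s (⨆ k, τ k) Φ x) {H : ℝ}
    (hH : ∀ u ∈ Icc (s - ⨆ k, τ k) s, ‖x u‖ ≤ H) {t : ℝ} (ht : s ≤ t) :
    ‖x t‖ ≤ Real.exp ((∑ k, essNorm t₀ (B k) + 1) * ((⨆ k, τ k) + (t - s))) * H := by
  set r := ⨆ k, τ k with hr
  set b := ∑ k, essNorm t₀ (B k) with hb
  have hr0 : 0 ≤ r := hadm.iSup_nonneg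
  have hb0 : 0 ≤ b := Finset.sum_nonneg fun k _ => essNorm_nonneg _ _
  have hH0 : 0 ≤ H := (norm_nonneg _).trans (hH s ⟨by linarith, le_rfl⟩)
  have hK : H ≤ Real.exp ((b + 1) * r) * H :=
    le_mul_of_one_le_left hH0 (Real.one_le_exp (by positivity))
  -- With this decreasing weight, history at most `M` gives weighted velocity at most `b M`, while
  -- the weight contributes `-(b + 1)` times the weighted norm; hence the ratio `θ = b / (b + 1)`.
  -- The factor `exp ((b + 1) r)` covers the weight on `[s - r, s]`.
  have key : Real.exp (-(b + 1) * (t - s)) * ‖x t‖ ≤ Real.exp ((b + 1) * r) * H := by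
    refine AbsolutelyContinuousOnInterval.le_of_contractive_level
      (f := fun u => Real.exp (-(b + 1) * (u - s)) * ‖x u‖) (θ := b / (b + 1))
      (fun T hT => (hx.absolutelyContinuous T hT).norm.exp_mul _ s) (by positivity)
      (by simpa using (hH s ⟨by linarith, le_rfl⟩).trans hK)
      ((div_lt_one (by positivity)).2 (by linarith)) ?_ ht
    intro T hT M hM hle
    have hhist : ∀ u ∈ Icc (s - r) T, Real.exp (-(b + 1) * (u - s)) * ‖x u‖ ≤ M := by
      intro u hu
      rcases le_total s u with h1 | h1
      · exact hle u ⟨h1, hu.2⟩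
      · refine le_trans ?_ hM
        refine mul_le_mul (Real.exp_le_exp.2 ?_) (hH u ⟨hu.1, h1⟩) (norm_nonneg _)
          (Real.exp_pos _).le
        nlinarith [hu.1]
    have hvel := ae_exp_mul_norm_velocity_le hadm hs (c := 0)
      (fun δ h0 _ => by nlinarith) hhist
    filter_upwards [hvel, hx.ae_hasDerivAt] with u hu hxu hmem _ hlev w hw
    obtain ⟨d, hd, rfl⟩ := hasDerivAt_of_exp_mul hw
    have h1 := (hxu hmem.1).norm_le hd
    have h2 := hu hmem
    have h3 : Real.exp (-(b + 1) * (u - s)) * d ≤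
        Real.exp (-(b + 1) * (u - s)) * ‖∑ k, B k u (x (h k u))‖ := by gcongr
    rw [Real.exp_zero, one_mul] at h2
    rw [div_mul_eq_mul_div, div_lt_iff₀ (by positivity)] at hlev
    linarith
  have e : ‖x t‖ = Real.exp ((b + 1) * (t - s)) * (Real.exp (-(b + 1) * (t - s)) * ‖x t‖) := by
    rw [← mul_assoc, ← Real.exp_add, neg_mul, add_neg_cancel, Real.exp_zero, one_mul]
  rw [e, mul_add, Real.exp_add, mul_comm (Real.exp ((b + 1) * r)), mul_assoc]
  gcongr

/-- A weighted bound on the velocity controls the difference of delayed and current state. -/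
theorem exp_mul_norm_sub_le {r : ℝ} (hx : IsSolution B h s r Φ x) {γ ρ R V T t η : ℝ}
    (hγ : 0 ≤ γ) (hV0 : 0 ≤ V)
    (hV : ∀ᵐ u, u ∈ Icc s T →
      Real.exp (γ * (u - s)) * ‖∑ k, B k u (x (h k u))‖ ≤ V)
    (hρR : ρ ≤ R) (htT : t ≤ T) (hη : s ≤ η) (hηt : η ≤ t) (hρ : t - η ≤ ρ) :
    Real.exp (γ * (t - s)) * ‖x η - x t‖ ≤ ρ * (Real.exp (γ * R) * V) := by
  have hac : AbsolutelyContinuousOnInterval (fun u => ‖x u - x η‖) η t := by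
    have h1 : AbsolutelyContinuousOnInterval x η t :=
      (hx.absolutelyContinuous t (hη.trans hηt)).mono (by
        rw [uIcc_of_le hηt, uIcc_of_le (hη.trans hηt)]
        exact Icc_subset_Icc_left hη)
    have h2 : AbsolutelyContinuousOnInterval (fun _ : ℝ => x η) η t :=
      ContDiffOn.absolutelyContinuousOnInterval contDiffOn_const
    exact (h1.sub h2).norm
  -- On `[η, t]` the inverse weight exceeds its value at `t` by at most the factor `exp (γ R)`. The
  -- separate `ρ` keeps the individual delay `τₖ` as the linear factor.
  have h := hac.sub_le_mul_of_ae_hasDerivAt_le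
    (C := Real.exp (-(γ * (t - s))) * (Real.exp (γ * R) * V)) hηt (by
      filter_upwards [hV, hx.ae_hasDerivAt] with u hVu hxu hu d hd
      have hsu : s ≤ u := hη.trans hu.1.le
      have h1 := ((hxu hsu).sub_const (x η)).norm_le hd
      have h2 := hVu ⟨hsu, hu.2.trans htT⟩
      refine h1.trans ?_
      have h3 : ‖∑ k, B k u (x (h k u))‖ ≤ Real.exp (-(γ * (u - s))) * V := by
        rw [Real.exp_neg, ← div_eq_inv_mul, le_div_iff₀ (Real.exp_pos _), mul_comm]
        exact h2
      refine h3.trans ?_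
      rw [← mul_assoc, ← Real.exp_add]
      gcongr
      nlinarith [hu.1])
  rw [sub_self, norm_zero, sub_zero, norm_sub_rev] at h
  calc Real.exp (γ * (t - s)) * ‖x η - x t‖
      ≤ Real.exp (γ * (t - s)) *
        (Real.exp (-(γ * (t - s))) * (Real.exp (γ * R) * V) * (t - η)) := by gcongr
    _ = (Real.exp (γ * (t - s)) * Real.exp (-(γ * (t - s)))) *
        ((t - η) * (Real.exp (γ * R) * V)) := by ring
    _ = (t - η) * (Real.exp (γ * R) * V) := by rw [← Real.exp_add]; simp
    _ ≤ _ := by gcongr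

/-- For `t ≥ s + r` every `hₖ(t)` lies in `[s, t]`, where `x` is absolutely continuous and its
velocity can be integrated. -/
theorem exp_mul_norm_perturbation_le (hadm : IsAdmissible t₀ B h τ) (hs : t₀ ≤ s)
    (hx : IsSolution B h s (⨆ k, τ k) Φ x) {γ V T t : ℝ} (hγ : 0 ≤ γ) (hV0 : 0 ≤ V)
    (hV : ∀ᵐ u, u ∈ Icc s T →
      Real.exp (γ * (u - s)) * ‖∑ k, B k u (x (h k u))‖ ≤ V)
    (ht : t ∈ Icc (s + ⨆ k, τ k) T) :
    Real.exp (γ * (t - s)) * ‖∑ k, B k t (x (h k t) - x t)‖ ≤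
      (∑ k, τ k * ‖B k t‖) * (Real.exp (γ * ⨆ k, τ k) * V) := by
  have hst : s ≤ t := le_trans (le_add_of_nonneg_right hadm.iSup_nonneg) ht.1
  have htt : t₀ ≤ t := hs.trans hst
  calc Real.exp (γ * (t - s)) * ‖∑ k, B k t (x (h k t) - x t)‖
      ≤ Real.exp (γ * (t - s)) * ∑ k, ‖B k t‖ * ‖x (h k t) - x t‖ := by
        gcongr
        exact (norm_sum_le _ _).trans
          (Finset.sum_le_sum fun k _ => ContinuousLinearMap.le_opNorm _ _)
    _ = ∑ k, ‖B k t‖ * (Real.exp (γ * (t - s)) * ‖x (h k t) - x t‖) := by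
        rw [Finset.mul_sum]
        exact Finset.sum_congr rfl fun k _ => by ring
    _ ≤ ∑ k, ‖B k t‖ * (τ k * (Real.exp (γ * ⨆ k, τ k) * V)) := by
        refine Finset.sum_le_sum fun k _ => mul_le_mul_of_nonneg_left ?_ (norm_nonneg _)
        have d1 := hadm.delay_nonneg k t htt
        have d2 := hadm.delay_le k t htt
        have d3 := hadm.le_iSup k
        exact hx.exp_mul_norm_sub_le hγ hV0 hV d3 ht.2 (by linarith [ht.1]) (by linarith) d2
    _ = _ := by
        rw [Finset.sum_mul]
        exact Finset.sum_congr rfl fun k _ => by ring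

theorem velocity_eq (t : ℝ) : ∑ k, B k t (x (h k t)) =
    (∑ k, B k t) (x t) + ∑ k, B k t (x (h k t) - x t) := by
  simp [Finset.sum_sub_distrib]

/-- Decay of a solution whose weighted velocity is controlled by its weighted size. -/
theorem exp_mul_norm_le_of_velocity_bound [Nontrivial E] (hadm : IsAdmissible t₀ B h τ)
    (hs : t₀ ≤ s) (hx : IsSolution B h s (⨆ k, τ k) Φ x) {β γ K G p Q : ℝ} (hβ : 0 < β)
    (hμ : ∀ t, t₀ ≤ t → matrixMeasure (∑ k, B k t) ≤ -β)
    (hQ : Q = ∑ k, τ k * essNorm t₀ (fun t => (matrixMeasure (∑ j, B j t))⁻¹ • B k t))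
    (hγ : 0 ≤ γ) (hp0 : 0 ≤ p) (hG : 0 ≤ G) (hK : 0 ≤ K)
    (hp : Q * Real.exp (γ * ⨆ k, τ k) * p < 1 - γ / β)
    (hinit : ∀ u ∈ Icc (s - ⨆ k, τ k) (s + ⨆ k, τ k), Real.exp (γ * (u - s)) * ‖x u‖ ≤ K)
    (hvel : ∀ T, s + (⨆ k, τ k) ≤ T → ∀ M, K ≤ M →
      (∀ u ∈ Icc (s - ⨆ k, τ k) T, Real.exp (γ * (u - s)) * ‖x u‖ ≤ M) →
      ∀ᵐ u, u ∈ Icc s T →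
        Real.exp (γ * (u - s)) * ‖∑ k, B k u (x (h k u))‖ ≤ max (G * K) (p * M))
    {t : ℝ} (ht : s ≤ t) :
    Real.exp (γ * (t - s)) * ‖x t‖ ≤
      max 1 (Q * Real.exp (γ * ⨆ k, τ k) * G / (1 - γ / β)) * K := by
  have hr0 : 0 ≤ ⨆ k, τ k := hadm.iSup_nonneg
  set r := ⨆ k, τ k with hr
  have hQ0 : 0 ≤ Q := by
    rw [hQ]
    exact Finset.sum_nonneg fun k _ => mul_nonneg (hadm.tau_nonneg k) (essNorm_nonneg _ _)
  have hq0 : 0 ≤ Q * Real.exp (γ * r) := by positivity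
  set q := Q * Real.exp (γ * r) with hq
  have hα : 0 < 1 - γ / β := lt_of_le_of_lt (by positivity) hp
  set α := 1 - γ / β with hαdef
  -- Large enough that above level `L` the damping also dominates the `G * K` branch of the velocity
  -- bound.
  set L := max 1 (q * G / α) * K with hL
  have hKL : K ≤ L := le_mul_of_one_le_left hK (le_max_left _ _)
  have hGL : q * (G * K) ≤ α * L := by
    have h1 : q * G / α * K ≤ L := mul_le_mul_of_nonneg_right (le_max_right _ _) hK
    calc q * (G * K) = α * (q * G / α * K) := by field_simp
      _ ≤ _ := by gcongr
  rcases le_total t (s + r) with hts | hts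
  · exact (hinit t ⟨by linarith, hts⟩).trans hKL
  refine AbsolutelyContinuousOnInterval.le_of_contractive_level
    (f := fun u => Real.exp (γ * (u - s)) * ‖x u‖) (a := s + r) (θ := q * p / α)
    (fun T hT => ?_) (hK.trans hKL) ((hinit _ ⟨by linarith, le_rfl⟩).trans hKL)
    ((div_lt_one hα).2 hp) ?_ hts
  · refine ((hx.absolutelyContinuous T (by linarith)).norm.exp_mul γ s).mono ?_
    rw [uIcc_of_le hT, uIcc_of_le (by linarith)]
    exact Icc_subset_Icc_left (by linarith)
  intro T hT M hM hle
  have hhist : ∀ u ∈ Icc (s - r) T, Real.exp (γ * (u - s)) * ‖x u‖ ≤ M := by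
    intro u hu
    rcases le_total (s + r) u with h1 | h1
    · exact hle u ⟨h1, hu.2⟩
    · exact (hinit u ⟨hu.1, h1⟩).trans (hKL.trans hM)
  have hV := hvel T hT M (hKL.trans hM) hhist
  have hM0 : 0 ≤ M := hK.trans (hKL.trans hM)
  have hV0 : 0 ≤ max (G * K) (p * M) := (by positivity : 0 ≤ G * K).trans (le_max_left _ _)
  set V := max (G * K) (p * M) with hVdef
  filter_upwards [hadm.ae_norm_le_mul_matrixMeasure hβ hμ, hx.ae_hasDerivAt]
    with u hBu hxu hmem hlev1 hlev2 w hw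
  have hsu : s ≤ u := by linarith [hmem.1]
  have hu : t₀ ≤ u := hs.trans hsu
  obtain ⟨d, hd, rfl⟩ := hasDerivAt_of_exp_mul hw
  have hxu' := hxu hsu
  rw [velocity_eq] at hxu'
  have h1 := hasDerivAt_norm_le_matrixMeasure hxu' hd
  have h2 := hx.exp_mul_norm_perturbation_le hadm hs hγ hV0 hV hmem
  have h3 := hμ u hu
  set y := -matrixMeasure (∑ k, B k u) with hy
  have hy' : matrixMeasure (∑ k, B k u) = -y := by simp [hy]
  rw [hy'] at h1 h3
  have hyβ : β ≤ y := by linarith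
  have h4 : ∑ k, τ k * ‖B k u‖ ≤ Q * y := by
    rw [hQ, Finset.sum_mul]
    refine Finset.sum_le_sum fun k _ => ?_
    rw [mul_assoc]
    exact mul_le_mul_of_nonneg_left (hBu hu k) (hadm.tau_nonneg k)
  have h5 : Real.exp (γ * (u - s)) * ‖∑ k, B k u (x (h k u) - x u)‖ ≤ y * (q * V) := by
    refine h2.trans ((mul_le_mul_of_nonneg_right h4 (by positivity)).trans_eq ?_)
    rw [hq]
    ring
  have h6 : q * V ≤ α * (Real.exp (γ * (u - s)) * ‖x u‖) := by
    rw [hVdef, mul_max_of_nonneg _ _ hq0]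
    refine max_le (hGL.trans (mul_le_mul_of_nonneg_left hlev1.le hα.le)) ?_
    rw [div_mul_eq_mul_div, div_lt_iff₀ hα] at hlev2
    linarith
  -- Since `y ≥ β`, the growth of the weight uses only the fraction `γ / β` of the damping; `α = 1 -
  -- γ / β` is left for the perturbation.
  have h7 : γ ≤ y * (γ / β) := by
    calc γ = β * (γ / β) := by field_simp
      _ ≤ _ := by gcongr
  have h8 : y * (q * V) ≤ y * (α * (Real.exp (γ * (u - s)) * ‖x u‖)) :=
    mul_le_mul_of_nonneg_left h6 (hβ.le.trans hyβ)
  have h9 : Real.exp (γ * (u - s)) * d ≤ Real.exp (γ * (u - s)) *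
      (-y * ‖x u‖ + ‖∑ k, B k u (x (h k u) - x u)‖) := by gcongr
  have h10 : γ * (Real.exp (γ * (u - s)) * ‖x u‖) ≤
      y * (γ / β) * (Real.exp (γ * (u - s)) * ‖x u‖) := by gcongr
  rw [hαdef] at h8
  linarith

end IsSolution

end DelaySystem

/-! ### Velocity bounds and stability under each condition. -/

namespace DelaySystem

variable {E : Type*} [NormedAddCommGroup E] [NormedSpace ℝ E] {m : ℕ} {t₀ : ℝ}
  {B : Fin m → ℝ → E →L[ℝ] E} {h : Fin m → ℝ → ℝ} {τ : Fin m → ℝ}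

/-- If the delays are small compared with the coefficients, the weighted velocity of a solution
is controlled by the norm of `B = ∑ₖ Bₖ` and the weighted size of the solution. -/
theorem IsSolution.ae_exp_mul_norm_velocity_le_max {s : ℝ} {Φ x : ℝ → E}
    (hadm : IsAdmissible t₀ B h τ) (hs : t₀ ≤ s)
    (hx : IsSolution B h s (⨆ k, τ k) Φ x) {γ K M T : ℝ} (hγ : 0 ≤ γ) (hK : 0 ≤ K) (hKM : K ≤ M)
    (hσ : (∑ k, τ k * essNorm t₀ (B k)) * Real.exp (γ * ⨆ k, τ k) < 1)
    (hinit : ∀ u ∈ Icc (s - ⨆ k, τ k) (s + ⨆ k, τ k), Real.exp (γ * (u - s)) * ‖x u‖ ≤ K)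
    (hM : ∀ u ∈ Icc (s - ⨆ k, τ k) T, Real.exp (γ * (u - s)) * ‖x u‖ ≤ M) :
    ∀ᵐ u, u ∈ Icc s T → Real.exp (γ * (u - s)) * ‖∑ k, B k u (x (h k u))‖ ≤
      max ((∑ k, essNorm t₀ (B k)) * Real.exp (γ * ⨆ k, τ k) * K)
        (essNorm t₀ (fun t => ∑ k, B k t) /
          (1 - (∑ k, τ k * essNorm t₀ (B k)) * Real.exp (γ * ⨆ k, τ k)) * M) := by
  have hr0 : 0 ≤ ⨆ k, τ k := hadm.iSup_nonneg
  set r := ⨆ k, τ k with hr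
  set b := ∑ k, essNorm t₀ (B k) with hb
  have hb0 : 0 ≤ b := Finset.sum_nonneg fun k _ => essNorm_nonneg _ _
  have hσ0 : 0 ≤ ∑ k, τ k * essNorm t₀ (B k) :=
    Finset.sum_nonneg fun k _ => mul_nonneg (hadm.tau_nonneg k) (essNorm_nonneg _ _)
  have hM0 : 0 ≤ M := hK.trans hKM
  have hc : ∀ δ, 0 ≤ δ → δ ≤ r → γ * δ ≤ γ * r := fun δ _ h => by gcongr
  have hcoarse := ae_exp_mul_norm_velocity_le hadm hs hc hM
  have hstart := ae_exp_mul_norm_velocity_le hadm hs hc hinit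
  -- The coarse bound `hcoarse` only starts the iteration and leaves no trace in the result. `A`
  -- handles `[s, s + r]`; `D` is the contribution of `B x`.
  have key := ae_le_of_self_improving_bound (μ := volume.restrict (Icc s T))
    (f := fun u => Real.exp (γ * (u - s)) * ‖∑ k, B k u (x (h k u))‖)
    (A := b * Real.exp (γ * r) * K) (D := essNorm t₀ (fun t => ∑ k, B k t) * M)
    (by positivity) (by positivity) hσ ((ae_restrict_iff' measurableSet_Icc).2 hcoarse) (by
      intro V hV0 hV
      rw [ae_restrict_iff' measurableSet_Icc] at hV ⊢
      filter_upwards [hstart, hadm.ae_norm_le, hadm.ae_norm_sum_le] with u h1 h2 h3 hu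
      have htu : t₀ ≤ u := hs.trans hu.1
      rcases le_total u (s + r) with h4 | h4
      · refine le_max_of_le_left ((h1 ⟨hu.1, h4⟩).trans_eq ?_)
        ring
      · refine le_max_of_le_right ?_
        have h5 := hx.exp_mul_norm_perturbation_le hadm hs hγ hV0 hV (t := u) ⟨h4, hu.2⟩
        have h6 : ∑ k, τ k * ‖B k u‖ ≤ ∑ k, τ k * essNorm t₀ (B k) :=
          Finset.sum_le_sum fun k _ => mul_le_mul_of_nonneg_left (h2 htu k) (hadm.tau_nonneg k)
        have h7 := hM u ⟨by linarith [hu.1], hu.2⟩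
        rw [velocity_eq]
        calc Real.exp (γ * (u - s)) * ‖(∑ k, B k u) (x u) + ∑ k, B k u (x (h k u) - x u)‖
            ≤ Real.exp (γ * (u - s)) * (essNorm t₀ (fun t => ∑ k, B k t) * ‖x u‖
              + ‖∑ k, B k u (x (h k u) - x u)‖) := by
              gcongr
              refine (norm_add_le _ _).trans (add_le_add_left ?_ _)
              exact (ContinuousLinearMap.le_opNorm _ _).trans
                (mul_le_mul_of_nonneg_right (h3 htu) (norm_nonneg _))
          _ = essNorm t₀ (fun t => ∑ k, B k t) * (Real.exp (γ * (u - s)) * ‖x u‖)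
              + Real.exp (γ * (u - s)) * ‖∑ k, B k u (x (h k u) - x u)‖ := by ring
          _ ≤ essNorm t₀ (fun t => ∑ k, B k t) * M
              + (∑ k, τ k * ‖B k u‖) * (Real.exp (γ * r) * V) :=
              add_le_add (mul_le_mul_of_nonneg_left h7 (essNorm_nonneg _ _)) h5
          _ ≤ essNorm t₀ (fun t => ∑ k, B k t) * M
              + (∑ k, τ k * essNorm t₀ (B k)) * (Real.exp (γ * r) * V) := by gcongr
          _ = _ := by ring)
  rw [ae_restrict_iff' measurableSet_Icc] at key
  filter_upwards [key] with u hu hmem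
  refine (hu hmem).trans_eq ?_
  rw [div_mul_eq_mul_div]

/-- The common reduction: the two conditions differ only in the constants `p` and `G` of the
velocity bound. -/
theorem uniformlyExponentiallyStable_of_velocity_bound [Nontrivial E] [MeasurableSpace E]
    (hadm : IsAdmissible t₀ B h τ) {β γ p G : ℝ} (hβ : 0 < β)
    (hμ : ∀ t, t₀ ≤ t → matrixMeasure (∑ k, B k t) ≤ -β)
    (hγ : 0 < γ) (hp0 : 0 ≤ p) (hG : 0 ≤ G)
    (hp : (∑ k, τ k * essNorm t₀ (fun t => (matrixMeasure (∑ j, B j t))⁻¹ • B k t)) *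
      Real.exp (γ * ⨆ k, τ k) * p < 1 - γ / β)
    (hvel : ∀ s, t₀ ≤ s → ∀ Φ x, IsSolution B h s (⨆ k, τ k) Φ x → ∀ K, 0 ≤ K →
      (∀ u ∈ Icc (s - ⨆ k, τ k) (s + ⨆ k, τ k), Real.exp (γ * (u - s)) * ‖x u‖ ≤ K) →
      ∀ T, s + (⨆ k, τ k) ≤ T → ∀ M, K ≤ M →
      (∀ u ∈ Icc (s - ⨆ k, τ k) T, Real.exp (γ * (u - s)) * ‖x u‖ ≤ M) →
      ∀ᵐ u, u ∈ Icc s T →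
        Real.exp (γ * (u - s)) * ‖∑ k, B k u (x (h k u))‖ ≤ max (G * K) (p * M)) :
    UniformlyExponentiallyStable t₀ B h τ := by
  have hr0 : 0 ≤ ⨆ k, τ k := hadm.iSup_nonneg
  set r := ⨆ k, τ k with hr
  set b := ∑ k, essNorm t₀ (B k) with hb
  have hb0 : 0 ≤ b := Finset.sum_nonneg fun k _ => essNorm_nonneg _ _
  set Q := ∑ k, τ k * essNorm t₀ (fun t => (matrixMeasure (∑ j, B j t))⁻¹ • B k t) with hQ
  set L := max 1 (Q * Real.exp (γ * r) * G / (1 - γ / β)) with hL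
  have hL0 : 0 < L := lt_of_lt_of_le one_pos (le_max_left _ _)
  set c := Real.exp (γ * r) * Real.exp ((b + 1) * (r + r)) with hc
  have hc1 : 1 ≤ c := one_le_mul_of_one_le_of_one_le (Real.one_le_exp (by positivity))
    (Real.one_le_exp (by positivity))
  refine ⟨L * c, by positivity, γ, hγ, fun s hs Φ x hΦ hx t ht => ?_⟩
  rw [← hr] at hΦ hx ⊢
  set H := sSup ((fun u => ‖Φ u‖) '' Icc (s - r) s) with hH
  have hxH : ∀ u ∈ Icc (s - r) s, ‖x u‖ ≤ H := fun u hu => by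
    rw [hx.initial hu]
    exact le_csSup hΦ.bounded (mem_image_of_mem _ hu)
  have hH0 : 0 ≤ H := (norm_nonneg _).trans (hxH s ⟨by linarith, le_rfl⟩)
  have hinit : ∀ u ∈ Icc (s - r) (s + r), Real.exp (γ * (u - s)) * ‖x u‖ ≤ c * H := by
    intro u hu
    rcases le_total u s with h1 | h1
    · refine mul_le_mul ((Real.exp_le_one_iff.2 ?_).trans hc1) (hxH u ⟨hu.1, h1⟩) (norm_nonneg _)
        (by positivity)
      nlinarith
    · rw [hc, mul_assoc]
      refine mul_le_mul (Real.exp_le_exp.2 ?_) ?_ (norm_nonneg _) (Real.exp_pos _).le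
      · exact mul_le_mul_of_nonneg_left (by linarith [hu.2]) hγ.le
      · refine (hx.norm_le_exp_mul hadm hs hxH h1).trans ?_
        gcongr
        linarith [hu.2]
  have key := hx.exp_mul_norm_le_of_velocity_bound hadm hs hβ hμ hQ hγ.le hp0 hG
    (by positivity) hp hinit (hvel s hs Φ x hx (c * H) (by positivity) hinit) ht
  rw [← hr, ← hL, ← mul_assoc] at key
  rw [mul_right_comm, neg_mul, Real.exp_neg, ← div_eq_mul_inv, le_div_iff₀ (Real.exp_pos _),
    mul_comm]
  exact key

theorem uniformlyExponentiallyStable_of_sum_mul_sum_lt [Nontrivial E] [MeasurableSpace E]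
    (hadm : IsAdmissible t₀ B h τ) {β : ℝ} (hβ : 0 < β)
    (hμ : ∀ t, t₀ ≤ t → matrixMeasure (∑ k, B k t) ≤ -β)
    (hcond : (∑ k, essNorm t₀ (B k)) *
      (∑ k, τ k * essNorm t₀ (fun t => (matrixMeasure (∑ j, B j t))⁻¹ • B k t)) < 1) :
    UniformlyExponentiallyStable t₀ B h τ := by
  have hb0 : 0 ≤ ∑ k, essNorm t₀ (B k) := Finset.sum_nonneg fun k _ => essNorm_nonneg _ _
  -- At `γ = 0` this is the hypothesis; strictness and continuity carry it to small positive `γ`.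
  obtain ⟨γ, hγ1, hγ0⟩ : ∃ γ : ℝ,
      (∑ k, τ k * essNorm t₀ (fun t => (matrixMeasure (∑ j, B j t))⁻¹ • B k t)) *
        Real.exp (γ * ⨆ k, τ k) * ((∑ k, essNorm t₀ (B k)) * Real.exp (γ * ⨆ k, τ k))
        < 1 - γ / β ∧ 0 < γ := by
    generalize (∑ k, τ k * essNorm t₀ (fun t => (matrixMeasure (∑ j, B j t))⁻¹ • B k t)) = Q
      at hcond ⊢
    generalize (∑ k, essNorm t₀ (B k)) = b at hcond ⊢
    generalize (⨆ k, τ k) = r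
    have hev : ∀ᶠ γ in 𝓝 (0 : ℝ),
        Q * Real.exp (γ * r) * (b * Real.exp (γ * r)) < 1 - γ / β := by
      refine ContinuousAt.eventually_lt (by fun_prop) (by fun_prop) ?_
      simpa [mul_comm] using hcond
    exact ((hev.filter_mono nhdsWithin_le_nhds).and
      (self_mem_nhdsWithin : ∀ᶠ γ in 𝓝[>] (0 : ℝ), 0 < γ)).exists
  refine uniformlyExponentiallyStable_of_velocity_bound (G := 0) hadm hβ hμ hγ0
    (mul_nonneg hb0 (Real.exp_pos _).le) le_rfl hγ1 ?_
  intro s hs Φ x hx K hK _ T _ M hKM hM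
  have hvel := IsSolution.ae_exp_mul_norm_velocity_le hadm hs (c := γ * ⨆ k, τ k)
    (fun δ _ h => mul_le_mul_of_nonneg_left h hγ0.le) hM
  filter_upwards [hvel] with u hu hmem
  exact le_max_of_le_right ((hu hmem).trans_eq (mul_assoc _ _ _).symm)

theorem uniformlyExponentiallyStable_of_mul_sum_lt [Nontrivial E] [MeasurableSpace E]
    (hadm : IsAdmissible t₀ B h τ) {β : ℝ} (hβ : 0 < β)
    (hμ : ∀ t, t₀ ≤ t → matrixMeasure (∑ k, B k t) ≤ -β)
    (hcond : essNorm t₀ (fun t => ∑ k, B k t) *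
      (∑ k, τ k * essNorm t₀ (fun t => (matrixMeasure (∑ j, B j t))⁻¹ • B k t)) <
      1 - ∑ k, τ k * essNorm t₀ (B k)) :
    UniformlyExponentiallyStable t₀ B h τ := by
  have hb0 : 0 ≤ ∑ k, essNorm t₀ (B k) := Finset.sum_nonneg fun k _ => essNorm_nonneg _ _
  have hQ0 : 0 ≤ ∑ k, τ k * essNorm t₀ (fun t => (matrixMeasure (∑ j, B j t))⁻¹ • B k t) :=
    Finset.sum_nonneg fun k _ => mul_nonneg (hadm.tau_nonneg k) (essNorm_nonneg _ _)
  have hN0 : 0 ≤ essNorm t₀ (fun t => ∑ k, B k t) := essNorm_nonneg _ _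
  obtain ⟨γ, ⟨hγ1, hγ2⟩, hγ0⟩ : ∃ γ : ℝ,
      ((∑ k, τ k * essNorm t₀ (B k)) * Real.exp (γ * ⨆ k, τ k) < 1 ∧
      (∑ k, τ k * essNorm t₀ (fun t => (matrixMeasure (∑ j, B j t))⁻¹ • B k t)) *
        Real.exp (γ * ⨆ k, τ k) * essNorm t₀ (fun t => ∑ k, B k t) <
        (1 - γ / β) * (1 - (∑ k, τ k * essNorm t₀ (B k)) * Real.exp (γ * ⨆ k, τ k))) ∧
      0 < γ := by
    generalize (∑ k, τ k * essNorm t₀ (fun t => (matrixMeasure (∑ j, B j t))⁻¹ • B k t)) = Q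
      at hcond hQ0 ⊢
    generalize (∑ k, τ k * essNorm t₀ (B k)) = σ at hcond ⊢
    generalize essNorm t₀ (fun t => ∑ k, B k t) = N at hcond hN0 ⊢
    generalize (⨆ k, τ k) = r
    have hev1 : ∀ᶠ γ in 𝓝 (0 : ℝ), σ * Real.exp (γ * r) < 1 := by
      refine ContinuousAt.eventually_lt (by fun_prop) (by fun_prop) ?_
      -- Condition 2 already forces `σ < 1`, because its left side is nonnegative.
      have : 0 ≤ N * Q := by positivity
      simpa using (by linarith : σ < 1)
    have hev2 : ∀ᶠ γ in 𝓝 (0 : ℝ), Q * Real.exp (γ * r) * N <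
        (1 - γ / β) * (1 - σ * Real.exp (γ * r)) := by
      refine ContinuousAt.eventually_lt (by fun_prop) (by fun_prop) ?_
      simpa [mul_comm] using hcond
    exact (((hev1.and hev2).filter_mono nhdsWithin_le_nhds).and
      (self_mem_nhdsWithin : ∀ᶠ γ in 𝓝[>] (0 : ℝ), 0 < γ)).exists
  have hden := sub_pos.2 hγ1
  refine uniformlyExponentiallyStable_of_velocity_bound
    (p := essNorm t₀ (fun t => ∑ k, B k t) /
      (1 - (∑ k, τ k * essNorm t₀ (B k)) * Real.exp (γ * ⨆ k, τ k)))
    (G := (∑ k, essNorm t₀ (B k)) * Real.exp (γ * ⨆ k, τ k)) hadm hβ hμ hγ0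
    (div_nonneg hN0 hden.le) (mul_nonneg hb0 (Real.exp_pos _).le) ?_ ?_
  · rw [← mul_div_assoc, div_lt_iff₀ hden]
    exact hγ2
  · intro s hs Φ x hx K hK hinit T _ M hKM hM
    exact hx.ae_exp_mul_norm_velocity_le_max hadm hs hγ0.le hK hKM hγ1 hinit hM

end DelaySystem

theorem mainTheorem9 {E : Type*} [NormedAddCommGroup E] [NormedSpace ℝ E] [FiniteDimensional ℝ E]
    [MeasurableSpace E] [BorelSpace E] (m : ℕ) (t₀ : ℝ) (ht₀ : 0 ≤ t₀)
    (B : Fin m → ℝ → E →L[ℝ] E) (h : Fin m → ℝ → ℝ) (τ : Fin m → ℝ)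
    (hadm : DelaySystem.IsAdmissible t₀ B h τ)
    (β : ℝ) (hβ : 0 < β)
    (hμ : ∀ t, t₀ ≤ t → DelaySystem.matrixMeasure (∑ k, B k t) ≤ -β)
    (hcond :
      (∑ k, DelaySystem.essNorm t₀ (B k)) *
          (∑ k, τ k * DelaySystem.essNorm t₀
            (fun t => (DelaySystem.matrixMeasure (∑ j, B j t))⁻¹ • B k t)) < 1 ∨
      DelaySystem.essNorm t₀ (fun t => ∑ k, B k t) *
          (∑ k, τ k * DelaySystem.essNorm t₀
            (fun t => (DelaySystem.matrixMeasure (∑ j, B j t))⁻¹ • B k t)) <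
        1 - ∑ k, τ k * DelaySystem.essNorm t₀ (B k)) :
    DelaySystem.UniformlyExponentiallyStable t₀ B h τ := by
  -- In the zero space `‖I‖ = 0` and the limit defining the matrix measure does not exist, but every
  -- solution vanishes.
  rcases subsingleton_or_nontrivial E with hE | hE
  · refine ⟨1, one_pos, 1, one_pos, fun s _ Φ x _ _ t _ => ?_⟩
    rw [Subsingleton.elim (x t) 0, norm_zero]
    refine mul_nonneg (by positivity) (Real.sSup_nonneg ?_)
    rintro _ ⟨u, _, rfl⟩
    exact norm_nonneg _
  rcases hcond with hcond | hcond
  · exact DelaySystem.uniformlyExponentiallyStable_of_sum_mul_sum_lt hadm hβ hμ hcond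
  · exact DelaySystem.uniformlyExponentiallyStable_of_mul_sum_lt hadm hβ hμ hcond
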